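/- Let $\mathrm{AP}$ and $\mathrm{Var}$ be finite sets of propositions and variables. Formulas of parametric LTL (pLTL) are given by $$\varphi ::= a \mid \neg\varphi \mid \varphi\wedge\varphi \mid \mathsf{X}\varphi \mid \varphi\,\mathsf{U}\,\varphi \mid \Diamond_{\prec x}\varphi \mid \Diamond_{\prec c}\varphi ,$$ where $a\in\mathrm{AP}$, $x\in\mathrm{Var}$, $c\in\mathbb N$ and $\prec\;\in\{=,\le,<,>,\ge\}$. They are interpreted at positions $i$ of infinite words $w$ over $2^{\mathrm{AP}}$ under valuations $v:\mathrm{Var}\to\mathbb N$: the Boolean connectives, $\mathsf X$ and $\mathsf U$ have their usual LTL semantics, $(w,i,v)\models\Diamond_{\prec x}\varphi$ holds iff $(w,j,v)\models\varphi$ for some $j\ge i$ with $j\prec v(x)+i$, and likewise for $\Diamond_{\prec c}$ with $c$ in place of $v(x)$. For a finite discrete-time Markov chain $M$ with rational transition probabilities, an initial state, and states labelled by subsets of $\mathrm{AP}$, let $V_{>0}(\varphi)$ be the set of valuations $v$ such that, with positive probability, the trace of a random path of $M$ from its initial state satisfies $\varphi$ under $v$ at position $0$. Then the following decision problem is undecidable: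 given finite sets $\mathrm{AP}$ and $\mathrm{Var}$, such a Markov chain $M$, and a pLTL formula $\varphi$, is $V_{>0}(\varphi)=\emptyset$? -/

import Mathlib

namespace ParamLTL

/-- The comparison operators `=, ≤, <, >, ≥`. -/
inductive Cmp where
  | eq | le | lt | gt | ge

namespace Cmp

/-- `r.Holds a b` says that `a` and `b` are related by the operator `r`. -/
def Holds {α : Type*} [LE α] [LT α] : Cmp → α → α → Prop
  | eq, a, b => a = b
  | le, a, b => a ≤ b
  | lt, a, b => a < b
  | gt, a, b => b < a
  | ge, a, b => b ≤ a

/-- The number of an operator. -/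
def code : Cmp → ℕ
  | eq => 0
  | le => 1
  | lt => 2
  | gt => 3
  | ge => 4

theorem code_injective : Function.Injective code := by
  intro a b h
  cases a <;> cases b <;> first | rfl | simp [code] at h

end Cmp

/-! ### Parametric LTL -/

/-- The formulas of parametric LTL over the propositions `AP` and the variables `Var`. -/
inductive PLTL (AP Var : Type) where
  | atom (a : AP)
  | neg (φ : PLTL AP Var)
  | and (φ ψ : PLTL AP Var)
  | next (φ : PLTL AP Var)
  | untl (φ ψ : PLTL AP Var)
  | diaVar (r : Cmp) (x : Var) (φ : PLTL AP Var)
  | diaConst (r : Cmp) (c : ℕ) (φ : PLTL AP Var)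

namespace PLTL

variable {AP Var : Type}

/-- `φ.Sat w v i` is the satisfaction relation `(w, i, v) ⊨ φ` for an infinite word `w` over `2^AP`,
a position `i` and a variable valuation `v`. All temporal operators look at the future, the present
position included. -/
def Sat (w : ℕ → Set AP) (v : Var → ℕ) : PLTL AP Var → ℕ → Prop
  | atom a, i => a ∈ w i
  | neg φ, i => ¬ Sat w v φ i
  | and φ ψ, i => Sat w v φ i ∧ Sat w v ψ i
  | next φ, i => Sat w v φ (i + 1)
  | untl φ ψ, i => ∃ j, i ≤ j ∧ Sat w v ψ j ∧ ∀ l, i ≤ l → l < j → Sat w v φ l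
  | diaVar r x φ, i => ∃ j, i ≤ j ∧ r.Holds j (v x + i) ∧ Sat w v φ j
  | diaConst r c φ, i => ∃ j, i ≤ j ∧ r.Holds j (c + i) ∧ Sat w v φ j

/-- The code number of a formula with propositions `Fin k` and variables `Fin d`. -/
def code {k d : ℕ} : PLTL (Fin k) (Fin d) → ℕ
  | atom a => Nat.pair 0 a
  | neg φ => Nat.pair 1 (code φ)
  | and φ ψ => Nat.pair 2 (Nat.pair (code φ) (code ψ))
  | next φ => Nat.pair 3 (code φ)
  | untl φ ψ => Nat.pair 4 (Nat.pair (code φ) (code ψ))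
  | diaVar r x φ => Nat.pair 5 (Nat.pair r.code (Nat.pair x (code φ)))
  | diaConst r c φ => Nat.pair 6 (Nat.pair r.code (Nat.pair c (code φ)))

theorem code_injective {k d : ℕ} :
    Function.Injective (code : PLTL (Fin k) (Fin d) → ℕ) := by
  intro φ
  induction φ with
  | atom a =>
    intro ψ h
    cases ψ <;> simp [code, Nat.pair_eq_pair] at h
    simp [Fin.ext_iff, h]
  | neg φ ih =>
    intro ψ h
    cases ψ <;> simp [code, Nat.pair_eq_pair] at h
    rw [ih h]
  | and φ₁ φ₂ ih₁ ih₂ =>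
    intro ψ h
    cases ψ <;> simp [code, Nat.pair_eq_pair] at h
    rw [ih₁ h.1, ih₂ h.2]
  | next φ ih =>
    intro ψ h
    cases ψ <;> simp [code, Nat.pair_eq_pair] at h
    rw [ih h]
  | untl φ₁ φ₂ ih₁ ih₂ =>
    intro ψ h
    cases ψ <;> simp [code, Nat.pair_eq_pair] at h
    rw [ih₁ h.1, ih₂ h.2]
  | diaVar r x φ ih =>
    intro ψ h
    cases ψ <;> simp [code, Nat.pair_eq_pair] at h
    rw [Cmp.code_injective h.1, Fin.ext h.2.1, ih h.2.2]
  | diaConst r c φ ih =>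
    intro ψ h
    cases ψ <;> simp [code, Nat.pair_eq_pair] at h
    rw [Cmp.code_injective h.1, h.2.1, ih h.2.2]

end PLTL

/-! ### Markov chains -/

/-- A finite discrete-time Markov chain with rational transition probabilities, an initial state and
a labelling of the states by finite sets of propositions. -/
structure MarkovChain (AP : Type) where
  /-- the number of states -/
  numStates : ℕ
  /-- the transition matrix -/
  P : Fin numStates → Fin numStates → ℚ≥0
  /-- the matrix is stochastic -/
  sum_P : ∀ s, ∑ t, P s t = 1
  /-- the initial state -/
  init : Fin numStates
  /-- the labelling of the states -/
  label : Fin numStates → Finset AP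

namespace MarkovChain

variable {AP Var : Type} (M : MarkovChain AP)

/-- The distribution of the successor of a state. -/
noncomputable def step (s : Fin M.numStates) : PMF (Fin M.numStates) :=
  PMF.ofFintype (fun t => ((M.P s t : NNReal) : ENNReal)) (by
    have h := M.sum_P s
    have h' : ∑ t, (M.P s t : NNReal) = 1 := by exact_mod_cast congrArg (fun q : ℚ≥0 => (q : NNReal)) h
    exact_mod_cast congrArg (fun q : NNReal => (q : ENNReal)) h')

/-- The one-step transition kernel. -/
noncomputable def stepKernel :
    ProbabilityTheory.Kernel (Fin M.numStates) (Fin M.numStates) :=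
  ProbabilityTheory.Kernel.ofFunOfCountable fun s => (M.step s).toMeasure

instance : ProbabilityTheory.IsMarkovKernel M.stepKernel :=
  ⟨fun s => inferInstanceAs (MeasureTheory.IsProbabilityMeasure (M.step s).toMeasure)⟩

/-- The kernel that produces state number `n + 1` from the states number `0, …, n`: by the Markov
property it depends on state number `n` only. -/
noncomputable def historyKernel (n : ℕ) :
    ProbabilityTheory.Kernel ((_ : Finset.Iic n) → Fin M.numStates) (Fin M.numStates) :=
  M.stepKernel.comap (fun h => h ⟨n, Finset.mem_Iic.2 le_rfl⟩) (measurable_pi_apply _)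

instance (n : ℕ) : ProbabilityTheory.IsMarkovKernel (M.historyKernel n) :=
  inferInstanceAs (ProbabilityTheory.IsMarkovKernel (M.stepKernel.comap _ _))

/-- The probability measure on the infinite state sequences that is induced by the chain: state
number `0` is the initial state, and the later states are drawn successively by the transition
probabilities. -/
noncomputable def pathMeasure : MeasureTheory.Measure (ℕ → Fin M.numStates) :=
  ProbabilityTheory.Kernel.traj (X := fun _ => Fin M.numStates) M.historyKernel 0
    (fun _ => M.init)

/-- The paths of the chain: the sequences from the initial state all of whose steps have positive
probability. -/
def paths : Set (ℕ → Fin M.numStates) :=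
  {π | π 0 = M.init ∧ ∀ i, 0 < M.P (π i) (π (i + 1))}

/-- The trace of a state sequence. -/
def trace (π : ℕ → Fin M.numStates) : ℕ → Set AP :=
  fun i => (M.label (π i) : Set AP)

/-- The probability `Pr (M ⊨ v(φ))`. -/
noncomputable def prob (φ : PLTL AP Var) (v : Var → ℕ) : ENNReal :=
  M.pathMeasure {π | π ∈ M.paths ∧ φ.Sat (M.trace π) v 0}

/-- The valuation set `V_{≺ p}(φ)`. -/
def valuationSet (r : Cmp) (p : ENNReal) (φ : PLTL AP Var) : Set (Var → ℕ) :=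
  {v | r.Holds (M.prob φ v) p}

/-- The code number of a chain with propositions `Fin k`: number of states, initial state, matrix of
numerators and denominators, and matrix of truth values for the labels. -/
def code {k : ℕ} (M : MarkovChain (Fin k)) : ℕ :=
  Encodable.encode
    (M.numStates, (M.init : ℕ),
      List.ofFn fun s => List.ofFn fun t => ((M.P s t).num, (M.P s t).den),
      List.ofFn fun s => List.ofFn fun a => decide (a ∈ M.label s))

theorem code_injective {k : ℕ} : Function.Injective (code : MarkovChain (Fin k) → ℕ) := by
  rintro ⟨m, P, hP, s, L⟩ ⟨m', P', hP', s', L'⟩ h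
  have h' := Encodable.encode_injective h
  simp only [Prod.mk.injEq] at h'
  obtain ⟨rfl, hs, hP1, hL⟩ := h'
  have e1 : s = s' := Fin.ext hs
  have e2 : P = P' := by
    funext a b
    have := congrFun (List.ofFn_injective (congrFun (List.ofFn_injective hP1) a)) b
    simp only [Prod.mk.injEq] at this
    exact NNRat.ext_num_den this.1 this.2
  have e3 : L = L' := by
    funext a
    ext b
    simpa using congrFun (List.ofFn_injective (congrFun (List.ofFn_injective hL) a)) b
  subst e1 e2 e3
  rfl

end MarkovChain

/-! ### The emptiness problem as a decision problem -/

/-- An instance of the emptiness problem: finite sets of propositions and of variables, a Markov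
chain and a formula. -/
structure Problem where
  /-- the number of propositions -/
  numAP : ℕ
  /-- the number of variables -/
  numVar : ℕ
  /-- the Markov chain -/
  chain : MarkovChain (Fin numAP)
  /-- the formula -/
  formula : PLTL (Fin numAP) (Fin numVar)

namespace Problem

/-- The number by which an instance is given to an algorithm. -/
def code (I : Problem) : ℕ :=
  Nat.pair I.numAP (Nat.pair I.numVar (Nat.pair I.chain.code I.formula.code))

theorem code_injective : Function.Injective code := by
  rintro ⟨k, d, M, φ⟩ ⟨k', d', M', φ'⟩ h
  simp only [code, Nat.pair_eq_pair] at h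
  obtain ⟨rfl, rfl, hM, hφ⟩ := h
  rw [MarkovChain.code_injective hM, PLTL.code_injective hφ]

end Problem

/-- A property of objects that are given by code numbers is decidable if some algorithm, started on
the code of any object, halts with the correct answer. (It may do anything, including not halting,
on numbers that code no object.) -/
def AlgorithmicallyDecidable {α : Type*} (code : α → ℕ) (p : α → Prop) : Prop :=
  ∃ f : ℕ →. Bool, Partrec f ∧ ∀ a, ∃ b ∈ f (code a), (b = true ↔ p a)

end ParamLTL

/-!
The halting problem of one fixed Turing machine reduces to the emptiness problem.

Let the Markov chain be the complete graph on a finite alphabet, with uniform transition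
probabilities, each state being labelled by its own letter. All words are then paths, and every
finite word has positive probability as a prefix. So if a formula holds for all words that agree
with a given word on a long enough prefix, it holds with positive probability; and if it holds with
positive probability, it holds for some word (`MarkovChain.uniform_prob_pos`,
`MarkovChain.exists_sat_of_uniform_prob_pos`). It is left to write down a formula that describes a
halting computation and looks at a finite prefix only.

The letters are the cells of a tape, with a possible head, together with a separator. A computation
is the word of its successive configurations, each written as a row: a separator followed by a fixed
number of cells. If `P` is the length of a row, a letter of the next row is a function of the three
letters that surround the position above it, that is, the letter at `p + 1 + P` is a function of the
letters at `p`, `p + 1` and `p + 2` (`localRule_cell`, `tableau_succ_add`). The formula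
`X ◇_{= x}` looks at the position at distance `v x + 1`, so the variable provides the row length, and
the formula says: the first row is the initial configuration, and the local rule holds until a letter
with a halting head appears. This forces the word to be the tableau of the computation up to that
letter (`eq_tableau`). Conversely, if the machine halts, rows that are long enough for the whole
computation provide a valuation (`exists_halting`). A head that runs out of its row disappears for
good, so that rows that are too short produce no halting letter.

The machine is fixed: only its input depends on the instance of the halting problem, and it enters
the formula through a single constant `n`, since the input may be taken to consist of two fixed
symbols followed by `n` copies of a third one (`exists_undecidable_TM0`). So the code number of the
formula is a primitive recursive function of `n` (`primrec_code_haltingProblem`). The machine comes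
from Mathlib's translations of partial recursive functions to machines with stacks and then to
machines with one tape; the number `2 ^ n`, in binary, has the shape of input just described.
-/

namespace ParamLTL

open Turing MeasureTheory ProbabilityTheory

/-! ### A one-tape machine with undecidable halting problem -/

/-- The binary digits of `2 ^ n`, the least significant one first. -/
theorem trNat_two_pow (n : ℕ) :
    PartrecToTM2.trNat (2 ^ n) =
      List.replicate n PartrecToTM2.Γ'.bit0 ++ [PartrecToTM2.Γ'.bit1] := by
  have h : ∃ p : PosNum, (p : ℕ) = 2 ^ n ∧ PartrecToTM2.trPosNum p =
      List.replicate n PartrecToTM2.Γ'.bit0 ++ [PartrecToTM2.Γ'.bit1] := by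
    induction n with
    | zero => exact ⟨.one, by simp, rfl⟩
    | succ n ih =>
      obtain ⟨p, hp, hp'⟩ := ih
      refine ⟨.bit0 p, ?_, ?_⟩
      · rw [PosNum.cast_bit0, hp, pow_succ]; ring
      · rw [PartrecToTM2.trPosNum, hp', List.replicate_succ]; rfl
  obtain ⟨p, hp, hp'⟩ := h
  have : ((2 ^ n : ℕ) : Num) = Num.pos p := by
    rw [← hp, ← PosNum.of_to_nat]
  rw [PartrecToTM2.trNat, this, PartrecToTM2.trNum, hp']

theorem exists_undecidable_halting :
    ∃ h : ℕ →. ℕ, Partrec h ∧ ¬ ComputablePred fun n => (h n).Dom := by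
  refine ⟨fun n => Nat.Partrec.Code.eval (Denumerable.ofNat Nat.Partrec.Code n) 0,
    Nat.Partrec.Code.eval_part.comp (Computable.ofNat _) (Computable.const 0), fun hc => ?_⟩
  refine ComputablePred.halting_problem 0 ?_
  obtain ⟨f, hf, hf'⟩ := ComputablePred.computable_iff.1 hc
  refine ComputablePred.computable_iff.2 ⟨fun c => f (Encodable.encode c),
    hf.comp Computable.encode, ?_⟩
  funext c
  have := congrFun hf' (Encodable.encode c)
  simpa using this

/-- The domain of a partial recursive function is read off from its values at the powers of two, by
way of the function that maps `m` to the binary logarithm of `m`. -/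
theorem exists_code_undecidable :
    ∃ c : ToPartrec.Code, ¬ ComputablePred fun n : ℕ => (c.eval [2 ^ n]).Dom := by
  obtain ⟨h, hh, hu⟩ := exists_undecidable_halting
  have hlog : Primrec fun m : ℕ => Nat.findGreatest (fun k => 2 ^ k ≤ m) m := by
    refine Primrec.nat_findGreatest (p := fun m k => 2 ^ k ≤ m) Primrec.id ?_
    exact Primrec.nat_le.comp ((Primrec₂.unpaired'.1 Nat.Primrec.pow).comp (.const 2) .snd) .fst
  have hp : Nat.Partrec' fun v : List.Vector ℕ 1 =>
      h (Nat.findGreatest (fun k => 2 ^ k ≤ v.head) v.head) :=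
    Nat.Partrec'.part_iff₁.2 (hh.comp hlog.to_comp)
  obtain ⟨c, hc⟩ := ToPartrec.Code.exists_code hp
  refine ⟨c, fun H => hu (H.of_eq fun n => ?_)⟩
  have e : Nat.findGreatest (fun k => 2 ^ k ≤ 2 ^ n) (2 ^ n) = n := by
    rw [Nat.findGreatest_eq_iff]
    refine ⟨Nat.lt_two_pow_self.le, fun _ => le_rfl, fun k hk _ => ?_⟩
    exact not_le.2 (Nat.pow_lt_pow_right (by norm_num) hk)
  have hn : c.eval [2 ^ n] =
      pure <$> h (Nat.findGreatest (fun k => 2 ^ k ≤ 2 ^ n) (2 ^ n)) := hc ⟨[2 ^ n], rfl⟩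
  rw [hn, e]
  rfl

/-- The states outside a finite supporting set may be dropped from a machine. -/
theorem exists_finite_of_supports {Γ Λ : Type} [Inhabited Γ] [Inhabited Λ]
    (M : TM0.Machine Γ Λ) (S : Finset Λ) (hS : TM0.Supports M S) :
    ∃ (Λ' : Type) (_ : Inhabited Λ') (_ : Finite Λ') (M' : TM0.Machine Γ Λ'), ∀ l : List Γ,
      (StateTransition.eval (TM0.step M') (TM0.init l)).Dom ↔ (TM0.eval M l).Dom := by
  classical
  let _ : Inhabited S := ⟨⟨default, hS.1⟩⟩
  let f : PointedMap Γ Γ := ⟨id, rfl⟩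
  let g : PointedMap Λ S := ⟨fun q => if h : q ∈ S then ⟨q, h⟩ else default, dif_pos hS.1⟩
  refine ⟨S, inferInstance, inferInstance, M.map f f g Subtype.val, fun l => ?_⟩
  refine StateTransition.tr_eval_dom (TM0.Machine.map_respects M f f g
    Subtype.val hS (fun _ => rfl) fun q hq => ?_) ⟨hS.1, ?_⟩
  · exact congrArg Subtype.val (dif_pos hq)
  · rw [TM0.map_init f g l]
    exact congrArg TM0.init (List.map_id l)

/-- A machine with finitely many symbols and states, whose halting on inputs that consist of two
fixed symbols and `n` copies of a third one is undecidable. The input `2 ^ n` of the underlying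
code is written on the tape as the terminator `cons`, which also carries the mark of the bottom of
the stack, the digit `1`, and `n` digits `0`. -/
theorem exists_undecidable_TM0 :
    ∃ (Γ Λ : Type) (_ : Inhabited Γ) (_ : Inhabited Λ) (_ : Finite Γ) (_ : Finite Λ)
      (M : TM0.Machine Γ Λ) (a₀ a₁ b : Γ),
      ¬ ComputablePred fun n : ℕ =>
        (StateTransition.eval (TM0.step M) (TM0.init (a₀ :: a₁ :: List.replicate n b))).Dom := by
  obtain ⟨c, hc⟩ := exists_code_undecidable
  have hK : ∀ k : PartrecToTM2.K', k ∈ ({.main, .rev, .aux, .stack} : Finset _) := fun k => by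
    cases k <;> decide
  let _ : Fintype PartrecToTM2.K' := ⟨_, hK⟩
  let _ : Inhabited PartrecToTM2.Λ' := ⟨PartrecToTM2.trNormal c .halt⟩
  obtain ⟨Λ, _, _, M, hM⟩ := exists_finite_of_supports _ _ (TM1to0.tr_supports _
    (TM2to1.tr_supports PartrecToTM2.tr (PartrecToTM2.tr_supports c .halt)))
  let up : PartrecToTM2.Γ' → TM2to1.Γ' PartrecToTM2.K' (fun _ => PartrecToTM2.Γ') :=
    fun a => (false, Function.update (fun _ => none) .main (some a))
  refine ⟨TM2to1.Γ' PartrecToTM2.K' (fun _ => PartrecToTM2.Γ'), Λ, inferInstance, inferInstance,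
    ?_, inferInstance, M, (true, (up .cons).2), up .bit1, up .bit0,
    fun H => hc (H.of_eq fun n => ?_)⟩
  · unfold TM2to1.Γ'
    infer_instance
  have hl : TM2to1.trInit .main (PartrecToTM2.trList [2 ^ n]) =
      (true, (up .cons).2) :: up .bit1 :: List.replicate n (up .bit0) := by
    have hr : (PartrecToTM2.trList [2 ^ n]).reverse =
        .cons :: .bit1 :: List.replicate n .bit0 := by
      simp [PartrecToTM2.trList, trNat_two_pow]
    unfold TM2to1.trInit
    rw [hr]
    exact congrArg (List.cons _) (congrArg (List.cons _) List.map_replicate)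
  have hi : TM2.init .main (PartrecToTM2.trList [2 ^ n]) = PartrecToTM2.init c [2 ^ n] := by
    unfold TM2.init PartrecToTM2.init
    congr 1
    funext k
    cases k <;> rfl
  have h2 : (TM2.eval PartrecToTM2.tr .main (PartrecToTM2.trList [2 ^ n])).Dom ↔
      (c.eval [2 ^ n]).Dom := by
    refine Iff.trans (b := (StateTransition.eval (TM2.step PartrecToTM2.tr)
      (PartrecToTM2.init c [2 ^ n])).Dom) ?_ ?_
    · rw [← hi]
      exact Iff.rfl
    · rw [PartrecToTM2.tr_eval]
      exact Iff.rfl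
  have h1 := TM2to1.tr_eval_dom PartrecToTM2.tr .main (PartrecToTM2.trList [2 ^ n])
  rw [hl] at h1
  exact (hM _).trans ((iff_of_eq (congrArg Part.Dom (TM1to0.tr_eval _ _))).trans (h1.trans h2))

/-! ### The tableau of a computation -/

section Tableau

variable {Γ Λ : Type} [Inhabited Γ] [Inhabited Λ] (M : TM0.Machine Γ Λ)

/-- The letters of a tableau: `none` is the separator of the rows, and `some (g, o)` is a tape cell
with the symbol `g`; the head is on this cell if `o = some q`, where `q` is the state. -/
abbrev Cell (Γ Λ : Type) : Type := Option (Γ × Option Λ)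

/-- The letter number `j`, for `0 ≤ j ≤ P`, of the row of length `P` for the configuration `s.1`
with its head at the position `s.2` of the row. The letter number `P` is the separator of the next
row. The head may lie outside the row, and then no letter shows it. -/
def cell (P : ℕ) (s : TM0.Cfg Γ Λ × ℤ) (j : ℕ) : Cell Γ Λ :=
  if j = 0 ∨ j = P then none
  else some (s.1.Tape.nth (j - s.2), if (j : ℤ) = s.2 then some s.1.q else none)

/-- One step of the machine on a row of length `P`. Nothing changes if the machine halts, or if the
head is outside the row; so a head that has left the row never comes back. -/
def stepIn (P : ℕ) (s : TM0.Cfg Γ Λ × ℤ) : TM0.Cfg Γ Λ × ℤ :=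
  if 0 < s.2 ∧ s.2 < P then
    match M s.1.q (s.1.Tape.nth 0) with
    | none => s
    | some (q, .move .left) => (⟨q, s.1.Tape.move .left⟩, s.2 - 1)
    | some (q, .move .right) => (⟨q, s.1.Tape.move .right⟩, s.2 + 1)
    | some (q, .write a) => (⟨q, s.1.Tape.write a⟩, s.2)
  else s

/-- The state in which the head moves from the given cell in the direction `d`, if it does so. -/
def leaving (d : Dir) : Cell Γ Λ → Option Λ
  | some (g, some q) =>
    match M q g with
    | some (q', .move d') => if d' = d then some q' else none
    | _ => none
  | _ => none

/-- The letter below `b`, where `a` and `c` are the neighbours of `b` to the left and to the right.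
-/
def localRule (a b c : Cell Γ Λ) : Cell Γ Λ :=
  match b with
  | none => none
  | some (g, none) => some (g, (leaving M .right a).or (leaving M .left c))
  | some (g, some q) =>
    match M q g with
    | none => b
    | some (_, .move _) => some (g, none)
    | some (q', .write g') => some (g', some q')

theorem leaving_cell_of_ne (d : Dir) {P j : ℕ} {s : TM0.Cfg Γ Λ × ℤ} (h : (j : ℤ) ≠ s.2) :
    leaving M d (cell P s j) = none := by
  unfold cell
  split_ifs <;> rfl

theorem leaving_cell_head (d : Dir) {P j : ℕ} {s : TM0.Cfg Γ Λ × ℤ} (h : (j : ℤ) = s.2)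
    (h0 : 0 < s.2) (hP : s.2 < P) :
    leaving M d (cell P s j) = leaving M d (some (s.1.Tape.nth 0, some s.1.q)) := by
  unfold cell
  rw [if_neg (by omega), if_pos h, h, sub_self]

theorem leaving_cell_of_not_mem (d : Dir) {P j : ℕ} {s : TM0.Cfg Γ Λ × ℤ} (hj : j ≤ P)
    (h : ¬ (0 < s.2 ∧ s.2 < P)) : leaving M d (cell P s j) = none := by
  by_cases hjs : (j : ℤ) = s.2
  · unfold cell
    rw [if_pos (by omega)]
    rfl
  · exact leaving_cell_of_ne M d hjs

/-- The local rule computes the next row from a row. Nothing is assumed about the position of the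
head: a head that moves onto a separator is no longer shown, and `stepIn` leaves it there. -/
theorem localRule_cell {P i : ℕ} (hi : i + 1 < P) (s : TM0.Cfg Γ Λ × ℤ) :
    localRule M (cell P s i) (cell P s (i + 1)) (cell P s (i + 2)) =
      cell P (stepIn M P s) (i + 1) := by
  have hc : ∀ s : TM0.Cfg Γ Λ × ℤ, cell P s (i + 1) =
      some (s.1.Tape.nth (i + 1 - s.2), if (i + 1 : ℤ) = s.2 then some s.1.q else none) := by
    intro s
    rw [cell, if_neg (by omega)]
    push_cast
    rfl
  rw [hc, hc]
  by_cases hw : 0 < s.2 ∧ s.2 < P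
  · by_cases h1 : (i + 1 : ℤ) = s.2
    · rw [if_pos h1, h1, sub_self]
      simp only [localRule, stepIn, if_pos hw]
      rcases hM : M s.1.q (s.1.Tape.nth 0) with _ | ⟨q', (_ | _) | g'⟩
      · simp
      · have e : s.2 ≠ s.2 - 1 := by omega
        simp [Tape.move_left_nth, e]
      · simp [Tape.move_right_nth]
      · simp [Tape.write_nth, -Tape.nth_zero]
    · rw [if_neg h1]
      have hl : ∀ d, leaving M d (cell P s i) = if (i : ℤ) = s.2 then
          leaving M d (some (s.1.Tape.nth 0, some s.1.q)) else none := fun d => by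
        split_ifs with h
        · exact leaving_cell_head M d h hw.1 hw.2
        · exact leaving_cell_of_ne M d h
      have hr : ∀ d, leaving M d (cell P s (i + 2)) = if (i + 2 : ℤ) = s.2 then
          leaving M d (some (s.1.Tape.nth 0, some s.1.q)) else none := fun d => by
        split_ifs with h
        · exact leaving_cell_head M d (by push_cast; exact h) hw.1 hw.2
        · exact leaving_cell_of_ne M d (by push_cast; exact h)
      simp only [localRule, stepIn, if_pos hw, hl, hr]
      simp only [leaving]
      rcases hM : M s.1.q (s.1.Tape.nth 0) with _ | ⟨q', (_ | _) | g'⟩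
      · simp [h1]
      · have e : (i + 1 : ℤ) - (s.2 - 1) - 1 = i + 1 - s.2 := by ring
        have e' : (i + 2 : ℤ) = s.2 ↔ (i + 1 : ℤ) = s.2 - 1 := by omega
        simp [Tape.move_left_nth, e, e']
      · have e : (i + 1 : ℤ) - (s.2 + 1) + 1 = i + 1 - s.2 := by ring
        have e' : (i : ℤ) = s.2 ↔ (i + 1 : ℤ) = s.2 + 1 := by omega
        simp only [Tape.move_right_nth, e, e']
        simp
      · have e : (i + 1 : ℤ) - s.2 ≠ 0 := by omega
        simp only [Tape.write_nth, if_neg e, if_neg h1]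
        simp
  · have h1 : (i + 1 : ℤ) ≠ s.2 := by omega
    rw [stepIn, if_neg hw, if_neg h1]
    simp only [localRule, leaving_cell_of_not_mem M _ (by omega : i ≤ P) hw,
      leaving_cell_of_not_mem M _ (by omega : i + 2 ≤ P) hw, Option.or_none]

/-- The word of the successive rows of the computation that starts with `s`. -/
def tableau (P : ℕ) (s : TM0.Cfg Γ Λ × ℤ) (p : ℕ) : Cell Γ Λ :=
  cell P ((stepIn M P)^[p / P] s) (p % P)

/-- The case `j = P` is included, as row number `t + 1` begins with a separator. -/
theorem tableau_row {P : ℕ} (hP : 0 < P) (s : TM0.Cfg Γ Λ × ℤ) (t : ℕ) {j : ℕ} (hj : j ≤ P) :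
    tableau M P s (t * P + j) = cell P ((stepIn M P)^[t] s) j := by
  rcases hj.lt_or_eq with hj | rfl
  · rw [tableau, add_comm, Nat.add_mul_mod_self_right, Nat.mod_eq_of_lt hj,
      Nat.add_mul_div_right _ _ hP, Nat.div_eq_of_lt hj, zero_add]
  · rw [tableau, show t * j + j = (t + 1) * j by ring, Nat.mul_mod_left]
    simp [cell]

theorem tableau_succ_add {P : ℕ} (hP : 0 < P) (s : TM0.Cfg Γ Λ × ℤ) (p : ℕ) :
    tableau M P s (p + 1 + P) =
      localRule M (tableau M P s p) (tableau M P s (p + 1)) (tableau M P s (p + 2)) := by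
  obtain ⟨t, j, hj, hp⟩ : ∃ t j, j < P ∧ p + 1 = t * P + j :=
    ⟨(p + 1) / P, (p + 1) % P, Nat.mod_lt _ hP, (Nat.div_add_mod' _ _).symm⟩
  have e : p + 1 + P = (t + 1) * P + j := by rw [hp]; ring
  rw [e, hp, tableau_row M hP s _ hj.le, tableau_row M hP s _ hj.le]
  rcases j with _ | i
  · simp [cell, localRule]
  · rw [show p = t * P + i by omega, show t * P + i + 2 = t * P + (i + 2) by ring,
      tableau_row M hP s _ (by omega : i ≤ P), tableau_row M hP s _ (by omega : i + 2 ≤ P),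
      localRule_cell M hj, Function.iterate_succ_apply']

/-- A word that obeys the local rule is determined by its first row. With `P = 1` the rule for the
letter at `p + 1 + P` would refer to this letter itself. -/
theorem eq_tableau {P : ℕ} (hP : 1 < P) {s : TM0.Cfg Γ Λ × ℤ} {w : ℕ → Cell Γ Λ} {H : ℕ}
    (h0 : ∀ j ≤ P, w j = cell P s j)
    (hw : ∀ p < H, w (p + 1 + P) = localRule M (w p) (w (p + 1)) (w (p + 2))) :
    ∀ p ≤ H + P, w p = tableau M P s p := by
  intro p
  induction p using Nat.strong_induction_on with
  | _ p ih =>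
    intro hp
    by_cases hpP : p ≤ P
    · have := tableau_row M (by omega) s 0 hpP
      rw [zero_mul, zero_add] at this
      rw [h0 p hpP, this, Function.iterate_zero_apply]
    · obtain ⟨r, rfl⟩ : ∃ r, p = r + 1 + P := ⟨p - P - 1, by omega⟩
      rw [hw r (by omega), tableau_succ_add M (by omega), ih r (by omega) (by omega),
        ih (r + 1) (by omega) (by omega), ih (r + 2) (by omega) (by omega)]

/-- A letter with a head that has no transition. -/
def Halting : Cell Γ Λ → Prop
  | some (g, some q) => M q g = none
  | _ => False

theorem stepIn_reaches (P : ℕ) (s : TM0.Cfg Γ Λ × ℤ) :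
    StateTransition.Reaches (TM0.step M) s.1 (stepIn M P s).1 := by
  unfold stepIn
  split_ifs
  · obtain ⟨⟨q, T⟩, h⟩ := s
    dsimp only
    rcases hM : M q (T.nth 0) with _ | ⟨q', (_ | _) | g'⟩
    · exact .refl
    all_goals
      refine .single ?_
      rw [Tape.nth_zero] at hM
      simp [TM0.step, hM]
  · exact .refl

theorem dom_of_halting {P : ℕ} {s : TM0.Cfg Γ Λ × ℤ} {p : ℕ} (h : Halting M (tableau M P s p)) :
    (StateTransition.eval (TM0.step M) s.1).Dom := by
  have hr : ∀ t, StateTransition.Reaches (TM0.step M) s.1 ((stepIn M P)^[t] s).1 := fun t => by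
    induction t with
    | zero => exact .refl
    | succ t ih =>
      rw [Function.iterate_succ_apply']
      exact ih.trans (stepIn_reaches M P _)
  refine Part.dom_iff_mem.2 ⟨_, StateTransition.mem_eval.2 ⟨hr (p / P), ?_⟩⟩
  unfold tableau cell at h
  generalize (stepIn M P)^[p / P] s = r at h
  split_ifs at h with h1 h2
  · exact h.elim
  · rw [h2, sub_self] at h
    obtain ⟨⟨q, T⟩, k⟩ := r
    change M q (T.nth 0) = none at h
    rw [Tape.nth_zero] at h
    simp [TM0.step, h]
  · exact h.elim

/-- During `N` steps the head moves by at most `N` positions, so rows with enough room on both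
sides of the head carry the true computation. -/
theorem exists_iterate_stepIn {c c' : TM0.Cfg Γ Λ} (h : StateTransition.Reaches (TM0.step M) c c') :
    ∃ N : ℕ, ∀ (P : ℕ) (k : ℤ), N < k → k + N < P →
      ∃ k', k - N ≤ k' ∧ k' ≤ k + N ∧ (stepIn M P)^[N] (c, k) = (c', k') := by
  induction h with
  | refl => exact ⟨0, fun P k _ _ => ⟨k, by simp, by simp, rfl⟩⟩
  | @tail b d _ hd ih =>
    obtain ⟨N, ih⟩ := ih
    refine ⟨N + 1, fun P k h1 h2 => ?_⟩
    push_cast at h1 h2 ⊢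
    obtain ⟨k', h3, h4, h5⟩ := ih P k (by omega) (by omega)
    rw [Function.iterate_succ_apply', h5, stepIn,
      if_pos ⟨by dsimp only; omega, by dsimp only; omega⟩]
    obtain ⟨q, T⟩ := b
    simp only [TM0.step, Option.mem_def, Option.map_eq_some_iff] at hd
    obtain ⟨⟨q', a⟩, hM, rfl⟩ := hd
    rw [← Tape.nth_zero] at hM
    dsimp only
    rw [hM]
    rcases a with (_ | _) | g
    · exact ⟨k' - 1, by omega, by omega, rfl⟩
    · exact ⟨k' + 1, by omega, by omega, rfl⟩
    · exact ⟨k', by omega, by omega, rfl⟩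

theorem exists_halting {c : TM0.Cfg Γ Λ} (h : (StateTransition.eval (TM0.step M) c).Dom) :
    ∃ N : ℕ, ∀ (P : ℕ) (k : ℤ), N < k → k + N < P → ∃ p, Halting M (tableau M P (c, k) p) := by
  obtain ⟨c', hc'⟩ := Part.dom_iff_mem.1 h
  obtain ⟨hr, hn⟩ := StateTransition.mem_eval.1 hc'
  obtain ⟨N, hN⟩ := exists_iterate_stepIn M hr
  refine ⟨N, fun P k h1 h2 => ?_⟩
  obtain ⟨k', h3, h4, h5⟩ := hN P k h1 h2
  lift k' to ℕ using by omega
  refine ⟨N * P + k', ?_⟩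
  rw [tableau_row M (by omega) _ _ (by omega), h5, cell, if_neg (by omega), if_pos rfl, sub_self,
    Tape.nth_zero]
  obtain ⟨q, T⟩ := c'
  change M q T.head = none
  simpa [TM0.step] using hn

end Tableau

/-! ### Formulas over words with one letter at each position -/

namespace PLTL

variable {AP Var : Type} {w : ℕ → Set AP} {v : Var → ℕ}

theorem sat_atom {a : AP} {i : ℕ} : Sat w v (atom a) i ↔ a ∈ w i := Iff.rfl

theorem sat_neg {φ : PLTL AP Var} {i : ℕ} : Sat w v (neg φ) i ↔ ¬ Sat w v φ i := Iff.rfl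

theorem sat_and {φ ψ : PLTL AP Var} {i : ℕ} :
    Sat w v (and φ ψ) i ↔ Sat w v φ i ∧ Sat w v ψ i := Iff.rfl

theorem sat_next {φ : PLTL AP Var} {i : ℕ} : Sat w v (next φ) i ↔ Sat w v φ (i + 1) := Iff.rfl

theorem sat_untl {φ ψ : PLTL AP Var} {i : ℕ} : Sat w v (untl φ ψ) i ↔
    ∃ j, i ≤ j ∧ Sat w v ψ j ∧ ∀ l, i ≤ l → l < j → Sat w v φ l := Iff.rfl

theorem sat_diaVar_eq {x : Var} {φ : PLTL AP Var} {i : ℕ} :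
    Sat w v (diaVar .eq x φ) i ↔ Sat w v φ (v x + i) :=
  ⟨fun ⟨_, _, hj, h⟩ => hj ▸ h, fun h => ⟨_, Nat.le_add_left _ _, rfl, h⟩⟩

theorem sat_diaConst_eq {c : ℕ} {φ : PLTL AP Var} {i : ℕ} :
    Sat w v (diaConst .eq c φ) i ↔ Sat w v φ (c + i) :=
  ⟨fun ⟨_, _, hj, h⟩ => hj ▸ h, fun h => ⟨_, Nat.le_add_left _ _, rfl, h⟩⟩

theorem sat_neg_diaVar_lt {x : Var} {φ : PLTL AP Var} {i : ℕ} :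
    Sat w v (neg (diaVar .lt x φ)) i ↔ ∀ j, i ≤ j → j < v x + i → ¬ Sat w v φ j := by
  simp [Sat, Cmp.Holds]

theorem sat_neg_diaConst_lt_neg {c : ℕ} {φ : PLTL AP Var} {i : ℕ} :
    Sat w v (neg (diaConst .lt c (neg φ))) i ↔ ∀ j, i ≤ j → j < c + i → Sat w v φ j := by
  simp [Sat, Cmp.Holds]

/-- The conjunction of `φ` and all formulas in `l`. -/
def conj (φ : PLTL AP Var) (l : List (PLTL AP Var)) : PLTL AP Var := l.foldr and φ

theorem sat_conj {φ : PLTL AP Var} {l : List (PLTL AP Var)} {i : ℕ} :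
    Sat w v (conj φ l) i ↔ Sat w v φ i ∧ ∀ ψ ∈ l, Sat w v ψ i := by
  induction l with
  | nil => simp [conj]
  | cons ψ l ih =>
    change Sat w v ψ i ∧ Sat w v (conj φ l) i ↔ _
    rw [ih, List.forall_mem_cons]
    tauto

/-- A formula that holds everywhere. -/
def taut (a : AP) : PLTL AP Var := neg (and (atom a) (neg (atom a)))

theorem sat_taut {a : AP} {i : ℕ} : Sat w v (taut a) i := fun h => h.2 h.1

variable {X : Type} [Fintype X] (e : X → AP) (a : AP)

/-- The present letter satisfies `p`, where `e` names the letters by propositions. The proposition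
`a` is used in a tautology only. -/
noncomputable def letterIn (p : X → Prop) : PLTL AP Var :=
  open scoped Classical in
  neg (conj (taut a) ((Finset.univ.filter p).toList.map fun b => neg (atom (e b))))

/-- Counting from the present position `i`, the letter at `i + 1 + (v x + 1)` is the value of `δ`
at the letters at `i`, `i + 1` and `i + 2`. The distance `v x + 1`, instead of `v x`, is never
zero, and it makes it possible to speak of the `v x` positions strictly between two separators. -/
noncomputable def shiftRule (x : Var) (δ : X → X → X → X) : PLTL AP Var :=
  conj (taut a) ((Finset.univ : Finset (X × X × X)).toList.map fun t =>
    neg (and (atom (e t.1)) (and (next (atom (e t.2.1))) (and (next (next (atom (e t.2.2))))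
      (neg (next (next (diaVar .eq x (atom (e (δ t.1 t.2.1 t.2.2)))))))))))

variable {e a} {f : ℕ → X}

theorem sat_letterIn (hf : ∀ i b, e b ∈ w i ↔ f i = b) {p : X → Prop} {i : ℕ} :
    Sat w v (letterIn e a p) i ↔ p (f i) := by
  rw [letterIn, Sat, sat_conj]
  simp [sat_taut, Sat, hf]

theorem sat_shiftRule (hf : ∀ i b, e b ∈ w i ↔ f i = b) {x : Var} {δ : X → X → X → X} {i : ℕ} :
    Sat w v (shiftRule e a x δ) i ↔
      f (i + 1 + (v x + 1)) = δ (f i) (f (i + 1)) (f (i + 2)) := by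
  rw [shiftRule, sat_conj, List.forall_mem_map]
  have h : v x + (i + 1 + 1) = i + 1 + (v x + 1) := by ring
  simp [sat_taut, sat_neg, sat_and, sat_next, sat_atom, hf, sat_diaVar_eq, h]

end PLTL

section Encoding

open PLTL

variable {Γ Λ : Type} [Inhabited Γ] [Inhabited Λ]

theorem nth_mk₁ (l : List Γ) (i : ℤ) :
    (Tape.mk₁ l).nth i = if i < 0 then default else l.getI i.toNat := by
  rcases i with i | i
  · rw [if_neg (by simp)]
    exact Tape.mk'_nth_nat _ _ _
  · rw [if_pos (Int.negSucc_lt_zero i)]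
    change ((Tape.mk₁ l).left).nth i = default
    rw [Tape.mk₁, Tape.mk₂, Tape.mk'_left, ListBlank.nth_mk, List.getI_nil]

theorem cell_init (a₀ a₁ b : Γ) {n P h j : ℕ} (h0 : 0 < j) (hP : j < P) :
    cell P ((TM0.init (a₀ :: a₁ :: List.replicate n b) : TM0.Cfg Γ Λ), (h : ℤ)) j =
      if j < h then some (default, none)
      else if j = h then some (a₀, some default)
      else if j = h + 1 then some (a₁, none)
      else if j < n + (h + 2) then some (b, none)
      else some (default, none) := by
  rw [cell, if_neg (by omega)]
  simp only [TM0.init, nth_mk₁, Nat.cast_inj]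
  rcases lt_or_ge j h with hj | hj
  · rw [if_pos (by omega), if_neg hj.ne, if_pos hj]
  · obtain ⟨d, rfl⟩ := Nat.exists_eq_add_of_le hj
    rw [if_neg (by omega), if_neg (show ¬ h + d < h by omega),
      show ((h + d : ℕ) - (h : ℤ)).toNat = d by omega]
    rcases d with _ | _ | d
    · simp
    · simp
    · rw [if_neg (by omega), if_neg (by omega), if_neg (by omega), List.getI_cons_succ,
        List.getI_cons_succ]
      split_ifs with hd
      · rw [List.getI_eq_getElem _ (by simp; omega)]
        simp
      · rw [List.getI_eq_default _ (by simp; omega)]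

/-- The word starts with a separator `sep`, the next separator is at `v 0 + 1`, and the letters
between them are blanks `bl`, then `s₀`, `s₁`, `n` letters `b`, and blanks again. -/
def rowFormula {AP : Type} (sep bl s₀ s₁ b : AP) (n : ℕ) : PLTL AP (Fin 1) :=
  and (atom sep) <| and (next (neg (diaVar .lt 0 (atom sep)))) <|
    and (next (diaVar .eq 0 (atom sep))) <| next <| untl (atom bl) <| and (atom s₀) <| next <|
      and (atom s₁) <| next <| and (neg (diaConst .lt n (neg (atom b)))) <|
        diaConst .eq n (untl (atom bl) (atom sep))

theorem sat_rowFormula {AP X : Type} {e : X → AP} {sep bl s₀ s₁ b : X} {n : ℕ}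
    {w : ℕ → Set AP} {v : Fin 1 → ℕ} {f : ℕ → X} (hf : ∀ i a, e a ∈ w i ↔ f i = a) :
    Sat w v (rowFormula (e sep) (e bl) (e s₀) (e s₁) (e b) n) 0 ↔
      f 0 = sep ∧ (∀ j, 1 ≤ j → j < v 0 + 1 → f j ≠ sep) ∧ f (v 0 + 1) = sep ∧
      ∃ h, 1 ≤ h ∧ (f h = s₀ ∧ f (h + 1) = s₁ ∧ (∀ j, h + 2 ≤ j → j < n + (h + 2) → f j = b) ∧
        ∃ y, n + (h + 2) ≤ y ∧ f y = sep ∧ ∀ l, n + (h + 2) ≤ l → l < y → f l = bl) ∧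
        ∀ l, 1 ≤ l → l < h → f l = bl := by
  simp only [rowFormula, sat_and, sat_next, sat_atom, sat_untl, sat_neg_diaVar_lt, sat_diaVar_eq,
    sat_neg_diaConst_lt_neg, sat_diaConst_eq, hf, zero_add, add_assoc, Nat.reduceAdd, ne_eq]

/-- The first row shows the initial configuration on the input `a₀`, `a₁` and `n` symbols `b`, in a
row of length `v 0 + 1`. -/
noncomputable def initFormula {AP : Type} (e : Cell Γ Λ → AP) (a₀ a₁ b : Γ) (n : ℕ) :
    PLTL AP (Fin 1) :=
  rowFormula (e none) (e (some (default, none))) (e (some (a₀, some default)))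
    (e (some (a₁, none))) (e (some (b, none))) n

/-- The blanks that precede the head are not counted by the formula: any position `h` of the head
is allowed. -/
theorem sat_initFormula {AP : Type} {e : Cell Γ Λ → AP} {a₀ a₁ b : Γ} {n : ℕ}
    {w : ℕ → Set AP} {v : Fin 1 → ℕ} {f : ℕ → Cell Γ Λ} (hf : ∀ i a, e a ∈ w i ↔ f i = a) :
    Sat w v (initFormula e a₀ a₁ b n) 0 ↔
      ∃ h : ℕ, 0 < h ∧ n + (h + 2) ≤ v 0 + 1 ∧ ∀ j ≤ v 0 + 1,
        f j = cell (v 0 + 1) (TM0.init (a₀ :: a₁ :: List.replicate n b), (h : ℤ)) j := by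
  rw [initFormula, sat_rowFormula hf]
  generalize hP : v 0 + 1 = P
  constructor
  · rintro ⟨h0, hne, hPe, h, hh, ⟨e0, e1, e2, y, hy, hys, e3⟩, e4⟩
    -- No letter strictly between `0` and `y` is a separator, nor is one strictly between `0` and `P`.
    have hyP : P = y := by
      rcases lt_trichotomy P y with hlt | heq | hgt
      · exfalso
        by_cases c1 : P < h
        · simp [e4 P (by omega) c1] at hPe
        by_cases c2 : P = h
        · simp [c2, e0] at hPe
        by_cases c3 : P = h + 1
        · simp [c3, e1] at hPe
        by_cases c4 : P < n + (h + 2)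
        · simp [e2 P (by omega) c4] at hPe
        · simp [e3 P (by omega) hlt] at hPe
      · exact heq
      · exact absurd hys (hne y (by omega) hgt)
    subst hyP
    refine ⟨h, hh, hy, fun j hj => ?_⟩
    rcases Nat.eq_zero_or_pos j with rfl | hj0
    · simp [h0, cell]
    rcases hj.eq_or_lt with rfl | hjP
    · simp [hPe, cell]
    rw [cell_init a₀ a₁ b hj0 hjP]
    split_ifs with c1 c2 c3 c4
    · exact e4 j hj0 c1
    · rw [c2, e0]
    · rw [c3, e1]
    · exact e2 j (by omega) c4
    · exact e3 j (by omega) hjP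
  · rintro ⟨h, hh, hhP, hj⟩
    have hc : ∀ j, 0 < j → j < P → f j = _ := fun j h1 h2 =>
      (hj j h2.le).trans (cell_init a₀ a₁ b h1 h2)
    have hPe : f P = none := by simp [hj P le_rfl, cell]
    refine ⟨by simp [hj 0 (Nat.zero_le _), cell], fun j h1 h2 => ?_, hPe, h, hh,
      ⟨?_, ?_, fun j h1 h2 => ?_, P, hhP, hPe, fun j h1 h2 => ?_⟩, fun j h1 h2 => ?_⟩
    · rw [hc j h1 h2]
      split_ifs <;> simp
    · rw [hc h hh (by omega), if_neg (by omega), if_pos rfl]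
    · rw [hc (h + 1) (by omega) (by omega), if_neg (by omega), if_neg (by omega), if_pos rfl]
    · rw [hc j (by omega) (by omega), if_neg (by omega), if_neg (by omega), if_neg (by omega),
        if_pos h2]
    · rw [hc j (by omega) (by omega), if_neg (by omega), if_neg (by omega), if_neg (by omega),
        if_neg (by omega)]
    · rw [hc j (by omega) (by omega), if_pos h2]

variable [Fintype (Cell Γ Λ)] (M : TM0.Machine Γ Λ)

/-- The word is the tableau of a computation, up to a letter that shows that the machine halts. -/
noncomputable def haltFormula {AP : Type} (e : Cell Γ Λ → AP) (a₀ a₁ b : Γ) (n : ℕ) :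
    PLTL AP (Fin 1) :=
  and (initFormula e a₀ a₁ b n)
    (untl (shiftRule e (e none) 0 (localRule M)) (letterIn e (e none) (Halting M)))

theorem sat_haltFormula {AP : Type} {e : Cell Γ Λ → AP} {a₀ a₁ b : Γ} {n : ℕ}
    {w : ℕ → Set AP} {v : Fin 1 → ℕ} {f : ℕ → Cell Γ Λ} (hf : ∀ i a, e a ∈ w i ↔ f i = a) :
    Sat w v (haltFormula M e a₀ a₁ b n) 0 ↔
      (∃ h : ℕ, 0 < h ∧ n + (h + 2) ≤ v 0 + 1 ∧ ∀ j ≤ v 0 + 1,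
        f j = cell (v 0 + 1) (TM0.init (a₀ :: a₁ :: List.replicate n b), (h : ℤ)) j) ∧
      ∃ H, Halting M (f H) ∧ ∀ p < H,
        f (p + 1 + (v 0 + 1)) = localRule M (f p) (f (p + 1)) (f (p + 2)) := by
  refine and_congr (sat_initFormula hf) (exists_congr fun H => ?_)
  simp only [sat_letterIn hf, sat_shiftRule hf, Nat.zero_le, true_and, true_implies]

theorem dom_of_sat {AP : Type} {e : Cell Γ Λ → AP} {a₀ a₁ b : Γ} {n : ℕ}
    {w : ℕ → Set AP} {v : Fin 1 → ℕ} {f : ℕ → Cell Γ Λ} (hf : ∀ i a, e a ∈ w i ↔ f i = a)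
    (h : Sat w v (haltFormula M e a₀ a₁ b n) 0) :
    (StateTransition.eval (TM0.step M) (TM0.init (a₀ :: a₁ :: List.replicate n b))).Dom := by
  obtain ⟨⟨k, hk, hkP, h0⟩, H, hH, hr⟩ := (sat_haltFormula M hf).1 h
  rw [eq_tableau M (by omega) h0 hr H (by omega)] at hH
  exact dom_of_halting M hH

/-- Since the formula looks at a finite prefix only, it holds for all words that agree with the
tableau on a prefix of some length `K`. -/
theorem exists_sat_of_dom {a₀ a₁ b : Γ} {n : ℕ}
    (h : (StateTransition.eval (TM0.step M) (TM0.init (a₀ :: a₁ :: List.replicate n b))).Dom) :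
    ∃ (v : Fin 1 → ℕ) (g : ℕ → Cell Γ Λ) (K : ℕ), g 0 = none ∧
      ∀ (AP : Type) (e : Cell Γ Λ → AP) (w : ℕ → Set AP) (f : ℕ → Cell Γ Λ),
        (∀ i a, e a ∈ w i ↔ f i = a) → (∀ i ≤ K, f i = g i) →
          Sat w v (haltFormula M e a₀ a₁ b n) 0 := by
  obtain ⟨N, hN⟩ := exists_halting M h
  obtain ⟨p, hp⟩ := hN (2 * N + n + 3) (N + 1 : ℕ) (by push_cast; omega) (by push_cast; omega)
  -- The head has `N` cells to its left and, to its right, room for the input and for `N` moves.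
  refine ⟨fun _ => 2 * N + n + 2, tableau M (2 * N + n + 3)
    (TM0.init (a₀ :: a₁ :: List.replicate n b), ((N + 1 : ℕ) : ℤ)),
    p + (2 * N + n + 3), by simp [tableau, cell], fun AP e w f hf hfg => ?_⟩
  refine (sat_haltFormula M hf).2 ⟨⟨N + 1, by omega, by omega, fun j hj => ?_⟩, p, ?_,
    fun r hr => ?_⟩
  · have := tableau_row M (P := 2 * N + n + 3) (by omega)
      (TM0.init (a₀ :: a₁ :: List.replicate n b), ((N + 1 : ℕ) : ℤ)) 0 hj
    rw [zero_mul, zero_add] at this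
    rw [hfg j (by omega), this, Function.iterate_zero_apply]
  · rwa [hfg p (by omega)]
  · rw [hfg _ (by omega), hfg _ (by omega), hfg _ (by omega), hfg _ (by omega)]
    exact tableau_succ_add M (by omega) _ r

end Encoding

/-! ### The uniform Markov chain on an alphabet -/

namespace MarkovChain

/-- The chain whose states are the propositions, each labelled by itself, with all transition
probabilities equal. -/
def uniform (k : ℕ) (s : Fin k) : MarkovChain (Fin k) where
  numStates := k
  P _ _ := (k : ℚ≥0)⁻¹
  sum_P _ := by
    have : (k : ℚ≥0) ≠ 0 := Nat.cast_ne_zero.2 (Fin.pos s).ne'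
    simp [this]
  init := s
  label t := {t}

variable {AP : Type} (M : MarkovChain AP)

/-- A finite prefix of a path has positive probability. -/
theorem partialTraj_singleton_pos (π : ℕ → Fin M.numStates) (h : ∀ i, 0 < M.P (π i) (π (i + 1)))
    (n : ℕ) :
    0 < Kernel.partialTraj (X := fun _ => Fin M.numStates) M.historyKernel 0 n
      (fun _ => π 0) {Preorder.frestrictLe (π := fun _ => Fin M.numStates) n π} := by
  induction n with
  | zero =>
    rw [Kernel.partialTraj_zero, Kernel.deterministic_apply' _ _ (measurableSet_singleton _)]
    rw [Set.indicator_of_mem]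
    · exact one_pos
    · rw [Set.mem_singleton_iff]
      funext i
      have : (i : ℕ) = 0 := Nat.le_zero.1 (Finset.mem_Iic.1 i.2)
      simp [this]
  | succ n ih =>
    rw [Kernel.partialTraj_succ_eq_comp (Nat.zero_le n),
      Kernel.comp_apply' _ _ _ (measurableSet_singleton _)]
    have h1 : 0 < Kernel.partialTraj (X := fun _ => Fin M.numStates) M.historyKernel n (n + 1)
        (Preorder.frestrictLe (π := fun _ => Fin M.numStates) n π)
        {Preorder.frestrictLe (π := fun _ => Fin M.numStates) (n + 1) π} := by
      rw [Kernel.partialTraj_succ_self, Kernel.map_apply' _ (by fun_prop) _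
        (measurableSet_singleton _)]
      have hsub : {Preorder.frestrictLe (π := fun _ => Fin M.numStates) n π} ×ˢ
          {MeasurableEquiv.piSingleton (X := fun _ => Fin M.numStates) n (π (n + 1))} ⊆
          IicProdIoc (X := fun _ => Fin M.numStates) n (n + 1) ⁻¹'
            {Preorder.frestrictLe (π := fun _ => Fin M.numStates) (n + 1) π} := by
        rintro ⟨x, y⟩ ⟨rfl, rfl⟩
        rw [Set.mem_preimage, Set.mem_singleton_iff]
        funext ⟨i, hi⟩
        by_cases hin : i ≤ n
        · simp [IicProdIoc, hin]
        · obtain rfl : i = n + 1 := le_antisymm (Finset.mem_Iic.1 hi) (by omega)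
          simp [IicProdIoc, MeasurableEquiv.piSingleton]
      refine lt_of_lt_of_le ?_ (measure_mono hsub)
      have hm : Measurable (MeasurableEquiv.piSingleton (X := fun _ => Fin M.numStates) n) :=
        MeasurableEquiv.measurable _
      have hpre : MeasurableEquiv.piSingleton (X := fun _ => Fin M.numStates) n ⁻¹'
          {MeasurableEquiv.piSingleton (X := fun _ => Fin M.numStates) n (π (n + 1))} =
          {π (n + 1)} := by
        ext y
        simp
      rw [Kernel.prod_apply_prod, Kernel.id_apply, Measure.dirac_apply_of_mem (Set.mem_singleton _),
        one_mul, Kernel.map_apply' _ hm _ (measurableSet_singleton _), hpre]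
      change 0 < (M.step (π n)).toMeasure {π (n + 1)}
      rw [PMF.toMeasure_apply_singleton _ _ (measurableSet_singleton _)]
      change 0 < ((M.P (π n) (π (n + 1)) : NNReal) : ENNReal)
      exact_mod_cast h n
    refine lt_of_lt_of_le (ENNReal.mul_pos h1.ne' ih.ne') ?_
    rw [← lintegral_indicator_const (measurableSet_singleton _)]
    refine lintegral_mono fun x => ?_
    by_cases hx : x ∈ ({Preorder.frestrictLe (π := fun _ => Fin M.numStates) n π} : Set _)
    · rw [Set.indicator_of_mem hx, Set.mem_singleton_iff.1 hx]
    · rw [Set.indicator_of_notMem hx]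
      exact zero_le

theorem pathMeasure_cylinder_pos {π : ℕ → Fin M.numStates} (hπ : π ∈ M.paths) (n : ℕ) :
    0 < M.pathMeasure {ρ | ∀ i ≤ n, ρ i = π i} := by
  have h := M.partialTraj_singleton_pos π hπ.2 n
  rw [← Kernel.traj_map_frestrictLe_apply, Measure.map_apply (by fun_prop)
    (measurableSet_singleton _), hπ.1] at h
  refine lt_of_lt_of_le h (measure_mono fun ρ hρ i hi => ?_)
  exact congrFun (Set.mem_singleton_iff.1 hρ) ⟨i, Finset.mem_Iic.2 hi⟩

variable {Var : Type}

theorem mem_paths_uniform {k : ℕ} {s : Fin k} {π : ℕ → Fin k} :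
    π ∈ (uniform k s).paths ↔ π 0 = s := by
  refine and_iff_left fun i => ?_
  change 0 < (k : ℚ≥0)⁻¹
  exact inv_pos.2 (Nat.cast_pos.2 (Fin.pos s))

theorem trace_uniform {k : ℕ} {s : Fin k} (π : ℕ → Fin k) :
    (uniform k s).trace π = fun i => {π i} :=
  funext fun _ => Finset.coe_singleton _

theorem exists_sat_of_uniform_prob_pos {k : ℕ} {s : Fin k} {φ : PLTL (Fin k) Var} {v : Var → ℕ}
    (h : 0 < (uniform k s).prob φ v) : ∃ π : ℕ → Fin k, φ.Sat (fun i => {π i}) v 0 := by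
  obtain ⟨π, -, hπ⟩ := nonempty_of_measure_ne_zero h.ne'
  exact ⟨π, trace_uniform π ▸ hπ⟩

theorem uniform_prob_pos {k : ℕ} {s : Fin k} {φ : PLTL (Fin k) Var} {v : Var → ℕ}
    {π : ℕ → Fin k} (hπ : π 0 = s) {n : ℕ}
    (h : ∀ ρ : ℕ → Fin k, (∀ i ≤ n, ρ i = π i) → φ.Sat (fun i => {ρ i}) v 0) :
    0 < (uniform k s).prob φ v := by
  refine lt_of_lt_of_le ((uniform k s).pathMeasure_cylinder_pos (mem_paths_uniform.2 hπ) n)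
    (measure_mono fun ρ hρ => ⟨mem_paths_uniform.2 ((hρ 0 (Nat.zero_le n)).trans hπ), ?_⟩)
  have ht : (uniform k s).trace ρ = fun i => ({ρ i} : Set (Fin k)) := trace_uniform ρ
  rw [ht]
  exact h ρ hρ

end MarkovChain

/-! ### The reduction -/

section Reduction

theorem primrec_pair_const (c : ℕ) {f : ℕ → ℕ} (hf : Primrec f) :
    Primrec fun n => Nat.pair c (f n) :=
  Primrec₂.natPair.comp (.const c) hf

theorem primrec_code_and {k d : ℕ} {φ ψ : ℕ → PLTL (Fin k) (Fin d)}
    (hφ : Primrec fun n => (φ n).code) (hψ : Primrec fun n => (ψ n).code) :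
    Primrec fun n => ((φ n).and (ψ n)).code :=
  primrec_pair_const 2 (Primrec₂.natPair.comp hφ hψ)

theorem primrec_code_next {k d : ℕ} {φ : ℕ → PLTL (Fin k) (Fin d)}
    (hφ : Primrec fun n => (φ n).code) : Primrec fun n => (φ n).next.code :=
  primrec_pair_const 3 hφ

theorem primrec_code_rowFormula {k : ℕ} (sep bl s₀ s₁ b : Fin k) :
    Primrec fun n => (rowFormula sep bl s₀ s₁ b n).code := by
  have hd : ∀ (r : Cmp) (φ : PLTL (Fin k) (Fin 1)), Primrec fun n => (φ.diaConst r n).code :=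
    fun r φ => primrec_pair_const 6 (primrec_pair_const r.code
      (Primrec₂.natPair.comp .id (.const φ.code)))
  exact primrec_code_and (.const _) (primrec_code_and (.const _) (primrec_code_and (.const _)
    (primrec_code_next (primrec_pair_const 4 (Primrec₂.natPair.comp (.const _)
      (primrec_code_and (.const _) (primrec_code_next (primrec_code_and (.const _)
        (primrec_code_next (primrec_code_and (primrec_pair_const 1 (hd .lt _))
          (hd .eq _)))))))))))

variable {Γ Λ : Type} [Inhabited Γ] [Inhabited Λ] [Fintype (Cell Γ Λ)] (M : TM0.Machine Γ Λ)

/-- The instance of the emptiness problem that asks whether `M` halts on the input `a₀`, `a₁` and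
`n` symbols `b`. -/
noncomputable def haltingProblem {k : ℕ} (e : Cell Γ Λ ≃ Fin k) (a₀ a₁ b : Γ) (n : ℕ) :
    Problem where
  numAP := k
  numVar := 1
  chain := .uniform k (e none)
  formula := haltFormula M e a₀ a₁ b n

theorem valuationSet_haltingProblem {k : ℕ} (e : Cell Γ Λ ≃ Fin k) (a₀ a₁ b : Γ) (n : ℕ) :
    (haltingProblem M e a₀ a₁ b n).chain.valuationSet .gt 0
        (haltingProblem M e a₀ a₁ b n).formula = ∅ ↔
      ¬ (StateTransition.eval (TM0.step M) (TM0.init (a₀ :: a₁ :: List.replicate n b))).Dom := by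
  rw [iff_not_comm, ← ne_eq, ← Set.nonempty_iff_ne_empty]
  constructor
  · intro h
    obtain ⟨v, g, K, hg, hs⟩ := exists_sat_of_dom M h
    refine ⟨v, MarkovChain.uniform_prob_pos (π := fun i => e (g i)) (by rw [hg]) (n := K)
      fun ρ hρ => hs _ e _ (fun i => e.symm (ρ i)) (fun i a => ?_) fun i hi => ?_⟩
    · rw [Set.mem_singleton_iff, Equiv.symm_apply_eq, eq_comm]
    · rw [Equiv.symm_apply_eq, hρ i hi]
  · rintro ⟨v, hv⟩
    obtain ⟨π, hπ⟩ := MarkovChain.exists_sat_of_uniform_prob_pos hv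
    refine dom_of_sat M (f := fun i => e.symm (π i)) (fun i a => ?_) hπ
    rw [Set.mem_singleton_iff, Equiv.symm_apply_eq, eq_comm]

theorem primrec_code_haltingProblem {k : ℕ} (e : Cell Γ Λ ≃ Fin k) (a₀ a₁ b : Γ) :
    Primrec fun n => (haltingProblem M e a₀ a₁ b n).code := by
  change Primrec fun n => Nat.pair k (Nat.pair 1 (Nat.pair (MarkovChain.uniform k (e none)).code
    (haltFormula M e a₀ a₁ b n).code))
  refine primrec_pair_const k (primrec_pair_const 1 (primrec_pair_const _
    (primrec_code_and ?_ (.const _))))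
  exact primrec_code_rowFormula _ _ _ _ _

end Reduction

end ParamLTL

/-- It is undecidable whether `V_{> 0}(φ) = ∅`, for a given Markov chain and a given formula. -/
theorem proposition1 :
    ¬ ParamLTL.AlgorithmicallyDecidable ParamLTL.Problem.code
      (fun I : ParamLTL.Problem =>
        I.chain.valuationSet ParamLTL.Cmp.gt 0 I.formula = ∅) := by
  rintro ⟨d, hd, hdI⟩
  obtain ⟨Γ, Λ, _, _, _, _, M, a₀, a₁, b, hM⟩ := ParamLTL.exists_undecidable_TM0
  have : Fintype (ParamLTL.Cell Γ Λ) := Fintype.ofFinite _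
  let e := Fintype.equivFin (ParamLTL.Cell Γ Λ)
  have hI : ∀ n, ∃ c ∈ d (ParamLTL.haltingProblem M e a₀ a₁ b n).code, (c = true ↔
      ¬ (StateTransition.eval (Turing.TM0.step M)
        (Turing.TM0.init (a₀ :: a₁ :: List.replicate n b))).Dom) :=
    fun n => by
      obtain ⟨c, hc, hc'⟩ := hdI (ParamLTL.haltingProblem M e a₀ a₁ b n)
      exact ⟨c, hc, hc'.trans (ParamLTL.valuationSet_haltingProblem M e a₀ a₁ b n)⟩
  choose c hc hc' using hI
  have hcomp : Computable c :=
    (hd.comp (ParamLTL.primrec_code_haltingProblem M e a₀ a₁ b).to_comp).of_eq fun n =>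
      Part.eq_some_iff.2 (hc n)
  refine hM (ComputablePred.computable_iff.2 ⟨fun n => !c n, Primrec.not.to_comp.comp hcomp, ?_⟩)
  funext n
  have := hc' n
  cases hcn : c n <;> simp_all
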